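/- Let $k$ be a field, let $G$ be a chordal graph on the vertex set $[n]=\{1,\dots,n\}$ (a finite simple graph in which every cycle of length at least $4$ has a chord), and let $\Delta=\Delta(G)$ be its clique complex, i.e. the simplicial complex on $[n]$ whose faces are the sets of pairwise adjacent vertices (including $\emptyset$). Put $d=\dim\Delta+1$. Let $R=k[x_1,\dots,x_n]$, let $I(\Delta)=\langle \prod_{i\in F}x_i : F\subseteq[n],\ F\notin\Delta\rangle$, and let $k[\Delta]=R/I(\Delta)$ be the Stanley--Reisner ring. Let $h(\Delta)=(h_0,\dots,h_d)$ be the $h$-vector of $\Delta$, defined by $$\sum_{s\ge 0}\dim_k(k[\Delta]_s)\,z^s=\frac{\sum_{i=0}^d h_iz^i}{(1-z)^d},$$ with $h_i=0$ for $i>d$. Then the projective dimension $p$ of $k[\Delta]$ as an $R$-module is a natural number, and $$\sum_{\ell=0}^{j}(-1)^{\ell}\,h_{j-\ell}\binom{n-d}{\ell}=0\qquad\text{for every integer } j>p+2 .$$ -/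

import Mathlib

/-- A simple graph is chordal if every cycle of length at least four has a chord: an edge of the
graph joining two vertices of the cycle that is not an edge of the cycle. -/
def SimpleGraph.IsChordalGraph {V : Type*} (G : SimpleGraph V) : Prop :=
  ∀ (v : V) (c : G.Walk v v), c.IsCycle → 4 ≤ c.length →
    ∃ a ∈ c.support, ∃ b ∈ c.support, G.Adj a b ∧ s(a, b) ∉ c.edges

/-- A simplicial complex on the vertex set `Fin n`: a down-closed family of subsets that contains
all singletons. The empty set counts as a face (of dimension `-1`), also for `n = 0`. -/
structure FaceComplex (n : ℕ) where
  faces : Finset (Finset (Fin n))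
  empty_mem : ∅ ∈ faces
  singleton_mem : ∀ i : Fin n, {i} ∈ faces
  down_closed : ∀ {F H : Finset (Fin n)}, H ∈ faces → F ⊆ H → F ∈ faces

open Classical in
/-- The clique complex of a graph: its faces are the sets of pairwise adjacent vertices. -/
noncomputable def cliqueComplex {n : ℕ} (G : SimpleGraph (Fin n)) : FaceComplex n where
  faces := Finset.univ.filter fun F => G.IsClique (F : Set (Fin n))
  empty_mem := by simp
  singleton_mem := by simp
  down_closed := by
    intro F H hH hF
    simp only [Finset.mem_filter, Finset.mem_univ, true_and] at hH ⊢
    exact hH.subset (by exact_mod_cast hF)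

namespace FaceComplex

variable {n : ℕ}

/-- The largest number of vertices of a face. -/
def maxFaceCard (Δ : FaceComplex n) : ℕ := Δ.faces.sup Finset.card

/-- The dimension of a complex: the largest dimension `|F| - 1` of a face `F`. -/
def dim (Δ : FaceComplex n) : ℤ := (Δ.maxFaceCard : ℤ) - 1

/-- The Stanley–Reisner ideal, generated by the squarefree monomials `x^F` of the non-faces. -/
noncomputable def stanleyReisnerIdeal (Δ : FaceComplex n) (k : Type*) [Field k] :
    Ideal (MvPolynomial (Fin n) k) :=
  Ideal.span {m | ∃ F : Finset (Fin n), F ∉ Δ.faces ∧ m = ∏ i ∈ F, MvPolynomial.X i}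

/-- The Stanley–Reisner ring `k[Δ]`. -/
abbrev StanleyReisnerRing (Δ : FaceComplex n) (k : Type*) [Field k] : Type _ :=
  MvPolynomial (Fin n) k ⧸ Δ.stanleyReisnerIdeal k

/-- The degree `s` component of `k[Δ]`: the classes of the homogeneous polynomials of total
degree `s`. -/
noncomputable def gradedPiece (Δ : FaceComplex n) (k : Type*) [Field k] (s : ℕ) :
    Submodule k (Δ.StanleyReisnerRing k) :=
  (MvPolynomial.homogeneousSubmodule (Fin n) k s).map
    (Ideal.Quotient.mkₐ k (Δ.stanleyReisnerIdeal k)).toLinearMap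

/-- The Hilbert series `∑ s, dim_k k[Δ]_s z^s` of `k[Δ]`. -/
noncomputable def hilbertSeries (Δ : FaceComplex n) (k : Type*) [Field k] : PowerSeries ℤ :=
  PowerSeries.mk fun s => (Module.finrank k (Δ.gradedPiece k s) : ℤ)

/-- The entries of the `h`-vector: the coefficients of the numerator in
`H_{k[Δ]}(z) = (∑ i, h_i z^i) / (1 - z)^d`, where `d = dim Δ + 1`; the numerator is a polynomial
of degree at most `d`, so `h_i = 0` for `i > d`. -/
noncomputable def hVector (Δ : FaceComplex n) (k : Type*) [Field k] (i : ℕ) : ℤ :=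
  PowerSeries.coeff i ((1 - PowerSeries.X) ^ Δ.maxFaceCard * Δ.hilbertSeries k)

/-- The projective dimension of `k[Δ]` as a module over the polynomial ring. -/
noncomputable def projDim (Δ : FaceComplex n) (k : Type*) [Field k] : WithBot ℕ∞ :=
  CategoryTheory.projectiveDimension
    (ModuleCat.of (MvPolynomial (Fin n) k) (Δ.StanleyReisnerRing k))

end FaceComplex

/-!
Let `K = (1 - z) ^ n · H` be the numerator of the Hilbert series of `k[Δ]` over the denominator
`(1 - z) ^ n`. The alternating sum in question is the coefficient of `z ^ j` in `K`
(`sum_hVector_eq_coeff_kSeries`), so the claim bounds the degree of `K` in terms of the projective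
dimension `p`. In fact `deg K ≤ p + 1`.

Everything rests on cutting a chordal graph along clique separators. If the graph induced on `U` is
not complete, then `U = A ⊔ S ⊔ B` with `S` a clique and no edges between the nonempty sets `A` and
`B`, because minimal separators of chordal graphs are cliques
(`SimpleGraph.IsChordalGraph.exists_isCliqueSeparation`). The clique complex of `U` is then the union
of those of `A ∪ S` and `S ∪ B`, which meet in the simplex on `S`. On the side of ideals this gives an
exact sequence `0 → R/(I ∩ J) → R/I × R/J → R/(I + J) → 0` in which `I + J` is generated by the
variables outside `S`.

*Finiteness.* Quotients by variables have finite projective dimension, hence so has `k[Δ]`, by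
induction along these sequences.

*Upper bound for the degree.* Hilbert series are additive along these sequences, and a simplex on
`U` contributes `(1 - z) ^ (n - |U|)`. By induction, if `G` is not complete, some clique
separator `S` of `G` satisfies `deg K ≤ n - |S|`; here one uses that a separator of one side of a
clique separation still separates the whole graph
(`SimpleGraph.IsChordalGraph.exists_separation_coeff_kSeries`).

*Lower bound for `p`.* For every clique separator `S` one has `n - |S| ≤ p + 1`
(`SimpleGraph.IsCliqueSeparation.ncard_compl_le`). The `n - |S|` variables outside `S` are a regular
sequence annihilating `R/(I + J)`, so if `p + 2 ≤ n - |S|` then `Ext¹(R/(I + J), k[Δ]) = 0` and the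
exact sequence splits. A splitting sends `1` to a pair `(x, y)` with `x - y ≡ 1`; the variables of
`A` force the constant term of `x` to vanish and those of `B` force that of `y` to vanish, a
contradiction.
-/

/-! ### Clique separators of chordal graphs -/

namespace SimpleGraph

variable {V : Type*} {G : SimpleGraph V}

/-- The vertices `x` and `y` are joined by a walk of `G` all of whose vertices lie in `P`. -/
def ConnectedWithin (G : SimpleGraph V) (P : Set V) (x y : V) : Prop :=
  ∃ p : G.Walk x y, ∀ v ∈ p.support, v ∈ P

namespace ConnectedWithin

variable {P Q : Set V} {x y z : V}

lemma refl (hx : x ∈ P) : G.ConnectedWithin P x x :=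
  ⟨.nil, by simpa using hx⟩

lemma right_mem (h : G.ConnectedWithin P x y) : y ∈ P := by
  obtain ⟨p, hp⟩ := h
  exact hp _ p.end_mem_support

lemma mono (h : G.ConnectedWithin P x y) (hPQ : P ⊆ Q) : G.ConnectedWithin Q x y := by
  obtain ⟨p, hp⟩ := h
  exact ⟨p, fun v hv => hPQ (hp v hv)⟩

lemma symm (h : G.ConnectedWithin P x y) : G.ConnectedWithin P y x := by
  obtain ⟨p, hp⟩ := h
  exact ⟨p.reverse, by simpa using hp⟩

lemma trans (h : G.ConnectedWithin P x y) (h' : G.ConnectedWithin P y z) :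
    G.ConnectedWithin P x z := by
  obtain ⟨p, hp⟩ := h
  obtain ⟨q, hq⟩ := h'
  refine ⟨p.append q, fun v hv => ?_⟩
  rcases (Walk.mem_support_append_iff p q).1 hv with h | h
  exacts [hp v h, hq v h]

lemma adj_right (h : G.ConnectedWithin P x y) (hyz : G.Adj y z) (hz : z ∈ P) :
    G.ConnectedWithin P x z :=
  h.trans ⟨hyz.toWalk, by simpa using ⟨h.right_mem, hz⟩⟩

/-- A walk inside `P` that starts at `x` stays in the component of `x`. -/
lemma within_component (h : G.ConnectedWithin P x y) :
    G.ConnectedWithin {v | G.ConnectedWithin P x v} x y := by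
  classical
  obtain ⟨p, hp⟩ := h
  exact ⟨p, fun v hv => ⟨p.takeUntil v hv,
    fun w hw => hp w (p.support_takeUntil_subset_support hv hw)⟩⟩

/-- If adding the single vertex `s` to `P` joins `x` to `y`, then `s` has a neighbour in the
component of `x`. -/
lemma exists_adj_of_insert {s : V} (hx : x ∈ P) (h : ¬ G.ConnectedWithin P x y)
    (h' : G.ConnectedWithin (insert s P) x y) : ∃ v, G.ConnectedWithin P x v ∧ G.Adj v s := by
  by_contra! hs
  have key : ∀ {u w : V} (p : G.Walk u w), (∀ v ∈ p.support, v ∈ insert s P) →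
      G.ConnectedWithin P x u → G.ConnectedWithin P x w := by
    intro u w p
    induction p with
    | nil => exact fun _ h => h
    | @cons u v w huv p ih =>
      intro hp hu
      refine ih (fun v hv => hp v (by simp [hv])) ?_
      rcases hp v (by simp) with rfl | hv
      · exact absurd huv (hs u hu)
      · exact hu.adj_right huv hv
  obtain ⟨p, hp⟩ := h'
  exact h (key p hp (refl hx))

/-- A shortest walk inside `P` is a path without chords. -/
lemma exists_chordless_path (h : G.ConnectedWithin P x y) :
    ∃ p : G.Walk x y, p.IsPath ∧ (∀ v ∈ p.support, v ∈ P) ∧ p.IsChordless := by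
  classical
  have hex : ∃ m, ∃ p : G.Walk x y, (∀ v ∈ p.support, v ∈ P) ∧ p.length = m := by
    obtain ⟨p, hp⟩ := h
    exact ⟨_, p, hp, rfl⟩
  obtain ⟨p₀, hp₀, hlen₀⟩ := Nat.find_spec hex
  have hmin : ∀ q : G.Walk x y, (∀ v ∈ q.support, v ∈ P) → Nat.find hex ≤ q.length :=
    fun q hq => Nat.find_min' hex ⟨q, hq, rfl⟩
  set p := p₀.bypass
  have hp : ∀ v ∈ p.support, v ∈ P := fun v hv => hp₀ v (p₀.support_bypass_subset_support hv)
  have hlen : p.length ≤ Nat.find hex := hlen₀ ▸ p₀.length_bypass_le_length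
  have hlt : ∀ i j, i < j → j ≤ p.length → G.Adj (p.getVert i) (p.getVert j) →
      s(p.getVert i, p.getVert j) ∈ p.edges := by
    intro i j hij hj hadj
    -- the chord is a shortcut, so it cannot skip any vertex
    have hle := hmin ((p.take i).append (.cons hadj (p.drop j))) (fun v hv => by
      rcases (Walk.mem_support_append_iff _ _).1 hv with h | h
      · exact hp v ((p.isSubwalk_take i).support_subset h)
      · rw [Walk.support_cons, List.mem_cons] at h
        rcases h with rfl | h
        · exact hp _ (p.getVert_mem_support i)
        · exact hp v ((p.isSubwalk_drop j).support_subset h))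
    simp only [Walk.length_append, Walk.length_cons, Walk.take_length, Walk.drop_length] at hle
    obtain rfl : j = i + 1 := by omega
    exact (p.mk_mem_edges_iff_exists).2 ⟨i, hj, rfl⟩
  refine ⟨p, p₀.bypass_isPath, hp,
    Walk.isChordless_iff_forall_mem_edges.2 fun u v hu hv huv => ?_⟩
  obtain ⟨i, rfl, hi⟩ := Walk.mem_support_iff_exists_getVert.1 hu
  obtain ⟨j, rfl, hj⟩ := Walk.mem_support_iff_exists_getVert.1 hv
  rcases lt_trichotomy i j with hij | rfl | hij
  · exact hlt i j hij hj huv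
  · exact absurd rfl huv.ne
  · rw [Sym2.eq_swap]
    exact hlt j i hij hi huv.symm

end ConnectedWithin

/-- In a chordal graph, two vertices that have neighbours in each of two disjoint connected sets
without edges between them are adjacent: otherwise two shortest paths, one through either set,
would form a chordless cycle of length at least four. -/
lemma IsChordalGraph.adj_of_connectedWithin (hG : G.IsChordalGraph) {A B : Set V} {s t : V}
    (hAB : Disjoint A B) (hno : ∀ x ∈ A, ∀ y ∈ B, ¬ G.Adj x y)
    (hsA : s ∉ A) (hsB : s ∉ B) (htA : t ∉ A) (htB : t ∉ B) (hst : s ≠ t)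
    (hA : G.ConnectedWithin (A ∪ {s, t}) s t) (hB : G.ConnectedWithin (B ∪ {s, t}) s t) :
    G.Adj s t := by
  by_contra hadj
  obtain ⟨p, hp, hpA, hpc⟩ := hA.exists_chordless_path
  obtain ⟨q, hq, hqB, hqc⟩ := hB.symm.exists_chordless_path
  have hpne : 2 ≤ p.length := by
    by_contra! hlt
    interval_cases h : p.length
    · exact hst (Walk.eq_of_length_eq_zero h)
    · exact hadj (Walk.adj_of_length_eq_one h)
  have hqne : 2 ≤ q.length := by
    by_contra! hlt
    interval_cases h : q.length
    · exact hst.symm (Walk.eq_of_length_eq_zero h)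
    · exact hadj (Walk.adj_of_length_eq_one h).symm
  have hcyc : (p.append q).IsCycle := by
    cases p with
    | nil => exact absurd rfl hst
    | @cons _ v _ hsv p =>
      rw [Walk.cons_isPath_iff] at hp
      have hvA : v ∈ A := by
        rcases hpA v (by simp) with h | rfl | rfl
        · exact h
        · exact absurd rfl hsv.ne
        · exact absurd hsv hadj
      rw [Walk.cons_append, Walk.cons_isCycle_iff]
      refine ⟨?_, ?_⟩
      · rw [Walk.isPath_def, Walk.support_append, List.nodup_append]
        refine ⟨hp.1.support_nodup, hq.support_nodup.sublist (List.tail_sublist _), ?_⟩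
        rintro x hx y hy rfl
        have hxq : x ∈ q.support := List.mem_of_mem_tail hy
        have hxt : x ≠ t := by
          rintro rfl
          have := hq.support_nodup
          rw [← Walk.cons_tail_support] at this
          exact (List.nodup_cons.1 this).1 hy
        have hxs : x ≠ s := by
          rintro rfl
          exact hp.2 hx
        have h1 : x ∈ A := by simpa [hxs, hxt] using hpA x (by simp [hx])
        have h2 : x ∈ B := by simpa [hxs, hxt] using hqB x hxq
        exact Set.disjoint_left.1 hAB h1 h2
      · rw [Walk.edges_append, List.mem_append]
        rintro (h | h)
        · exact hp.2 (Walk.fst_mem_support_of_mem_edges _ h)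
        · rcases hqB v (Walk.snd_mem_support_of_mem_edges _ h) with h | rfl | rfl
          · exact Set.disjoint_left.1 hAB hvA h
          · exact hsA hvA
          · exact htA hvA
  obtain ⟨x, hx, y, hy, hxy, hne⟩ := hG s (p.append q) hcyc (by
    rw [Walk.length_append]; omega)
  rw [Walk.edges_append, List.mem_append, not_or] at hne
  -- a chord would join an inner vertex of one path to an inner vertex of the other
  have key : ∀ x ∈ p.support, ∀ y ∈ q.support, G.Adj x y →
      s(x, y) ∉ p.edges → s(x, y) ∉ q.edges → False := by
    intro x hx y hy hxy hxp hxq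
    by_cases hxq' : x ∈ q.support
    · exact hxq (hqc.mem_edges hxq' hy hxy)
    by_cases hyp' : y ∈ p.support
    · exact hxp (hpc.mem_edges hx hyp' hxy)
    have hxA : x ∈ A := by
      rcases hpA x hx with h | rfl | rfl
      · exact h
      · exact absurd q.end_mem_support hxq'
      · exact absurd q.start_mem_support hxq'
    have hyB : y ∈ B := by
      rcases hqB y hy with h | rfl | rfl
      · exact h
      · exact absurd p.start_mem_support hyp'
      · exact absurd p.end_mem_support hyp'
    exact hno x hxA y hyB hxy
  rcases (Walk.mem_support_append_iff p q).1 hx with hx | hx <;>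
    rcases (Walk.mem_support_append_iff p q).1 hy with hy | hy
  · exact hne.1 (hpc.mem_edges hx hy hxy)
  · exact key x hx y hy hxy hne.1 hne.2
  · exact key y hy x hx hxy.symm (Sym2.eq_swap ▸ hne.1) (Sym2.eq_swap ▸ hne.2)
  · exact hne.2 (hqc.mem_edges hx hy hxy)

/-- The set `U` of vertices is partitioned into `A`, `S` and `B`, where `A` and `B` are nonempty
and have no edges between them, and the separator `S` is a clique. -/
structure IsCliqueSeparation (G : SimpleGraph V) (U A S B : Set V) : Prop where
  union_eq : A ∪ S ∪ B = U
  disjoint_left : Disjoint A S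
  disjoint_right : Disjoint S B
  disjoint : Disjoint A B
  nonempty_left : A.Nonempty
  nonempty_right : B.Nonempty
  isClique : G.IsClique S
  not_adj : ∀ x ∈ A, ∀ y ∈ B, ¬ G.Adj x y

lemma IsCliqueSeparation.symm {U A S B : Set V} (h : G.IsCliqueSeparation U A S B) :
    G.IsCliqueSeparation U B S A where
  union_eq := by rw [← h.union_eq, Set.union_comm B S, Set.union_right_comm, Set.union_comm S A]
  disjoint_left := h.disjoint_right.symm
  disjoint_right := h.disjoint_left.symm
  disjoint := h.disjoint.symm
  nonempty_left := h.nonempty_right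
  nonempty_right := h.nonempty_left
  isClique := h.isClique
  not_adj x hx y hy hxy := h.not_adj y hy x hx hxy.symm

/-- Dirac: two non-adjacent vertices of a chordal graph are separated by a clique, since a
minimal separator is one. -/
lemma IsChordalGraph.exists_isCliqueSeparation (hG : G.IsChordalGraph) {U : Set V}
    (hfin : U.Finite) (hU : ¬ G.IsClique U) : ∃ A S B, G.IsCliqueSeparation U A S B := by
  classical
  obtain ⟨a, ha, b, hb, hab, hnadj⟩ : ∃ a ∈ U, ∃ b ∈ U, a ≠ b ∧ ¬ G.Adj a b := by
    simpa [IsClique, Set.Pairwise] using hU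
  -- a minimal set `S` separating `a` from `b` in `U`
  let F : Set (Set V) := {S | S ⊆ U \ {a, b} ∧ ¬ G.ConnectedWithin (U \ S) a b}
  have hFfin : F.Finite := hfin.finite_subsets.subset fun S hS => hS.1.trans Set.sdiff_subset
  have hFne : F.Nonempty := by
    refine ⟨U \ {a, b}, subset_rfl, fun h => ?_⟩
    have hsub : U \ (U \ {a, b}) = {a, b} := by
      rw [Set.sdiff_sdiff_cancel_left]
      rintro x (rfl | rfl)
      exacts [ha, hb]
    rw [hsub] at h
    obtain ⟨p, hp⟩ := h
    cases p with
    | nil => exact hab rfl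
    | @cons _ v _ hav p =>
      rcases hp v (by simp) with rfl | rfl
      · exact hav.ne rfl
      · exact hnadj hav
  obtain ⟨S, ⟨hSU, hS⟩, hSmin⟩ := hFfin.exists_minimal hFne
  have haS : a ∈ U \ S := ⟨ha, fun h => (hSU h).2 (by simp)⟩
  have hbS : b ∈ U \ S := ⟨hb, fun h => (hSU h).2 (by simp)⟩
  have hdiff : ∀ s ∈ S, U \ (S \ {s}) = insert s (U \ S) := by
    intro s hs
    ext x
    by_cases hxs : x = s
    · simp [hxs, (hSU hs).1]
    · simp [hxs]
  have hconn : ∀ s ∈ S, G.ConnectedWithin (insert s (U \ S)) a b := by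
    intro s hs
    by_contra hcon
    have : S ⊆ S \ {s} := hSmin ⟨Set.sdiff_subset.trans hSU, by rwa [hdiff s hs]⟩ Set.sdiff_subset
    exact (this hs).2 rfl
  have hnot : ∀ {c : V} {s : V}, s ∈ S → ¬ G.ConnectedWithin (U \ S) c s :=
    fun hs h => h.right_mem.2 hs
  -- two vertices of `S` are joined through the component of `c` for both `c = a` and `c = b`
  have hpath : ∀ {c s t : V}, (∃ v, G.ConnectedWithin (U \ S) c v ∧ G.Adj v s) →
      (∃ v, G.ConnectedWithin (U \ S) c v ∧ G.Adj v t) →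
      G.ConnectedWithin ({v | G.ConnectedWithin (U \ S) c v} ∪ {s, t}) s t := by
    rintro c s t ⟨v, hv, hvs⟩ ⟨w, hw, hwt⟩
    have h1 := (hv.within_component.mono (Set.subset_union_left (t := {s, t}))).adj_right hvs
      (by simp)
    have h2 := (hw.within_component.mono (Set.subset_union_left (t := {s, t}))).adj_right hwt
      (by simp)
    exact h1.symm.trans h2
  refine ⟨{v | G.ConnectedWithin (U \ S) a v}, S, (U \ S) \ {v | G.ConnectedWithin (U \ S) a v},
    ?_, ?_, ?_, ?_, ⟨a, .refl haS⟩, ⟨b, hbS, hS⟩, ?_, ?_⟩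
  · ext x
    have h1 : G.ConnectedWithin (U \ S) a x → x ∈ U \ S := fun h => h.right_mem
    have h2 : x ∈ S → x ∈ U := fun h => (hSU h).1
    simp only [Set.mem_union, Set.mem_sdiff, Set.mem_ofPred_eq] at h1 ⊢
    tauto
  · exact Set.disjoint_left.2 fun x hx hxS => hx.right_mem.2 hxS
  · exact Set.disjoint_left.2 fun x hxS hx => hx.1.2 hxS
  · exact Set.disjoint_left.2 fun x hx hx' => hx'.2 hx
  · intro s hs t ht hst
    refine hG.adj_of_connectedWithin (A := {v | G.ConnectedWithin (U \ S) a v})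
      (B := {v | G.ConnectedWithin (U \ S) b v}) ?_ ?_ (hnot hs) (hnot hs) (hnot ht) (hnot ht)
      hst ?_ ?_
    · exact Set.disjoint_left.2 fun x hx hx' => hS (hx.trans hx'.symm)
    · exact fun x hx y hy hxy => hS ((hx.adj_right hxy hy.right_mem).trans hy.symm)
    · exact hpath (ConnectedWithin.exists_adj_of_insert haS hS (hconn s hs))
        (ConnectedWithin.exists_adj_of_insert haS hS (hconn t ht))
    · have hS' : ¬ G.ConnectedWithin (U \ S) b a := fun h => hS h.symm
      exact hpath (ConnectedWithin.exists_adj_of_insert hbS hS' (hconn s hs).symm)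
        (ConnectedWithin.exists_adj_of_insert hbS hS' (hconn t ht).symm)
  · exact fun x hx y hy hxy => hy.2 (hx.adj_right hxy hy.1)

end SimpleGraph

/-! ### Regular sequences, projective dimension and the Mayer–Vietoris sequence -/

section Homological

open CategoryTheory Abelian RingTheory.Sequence

universe u

variable {R : Type u} [CommRing R]

/-- If `N` is annihilated by an `M`-regular sequence of length `r`, then `Ext^i(N, M) = 0` for
`i < r`. -/
lemma subsingleton_ext_of_isWeaklyRegular {N M : ModuleCat.{u} R} {rs : List R}
    (hN : ∀ r ∈ rs, r ∈ Module.annihilator R N) (hM : IsWeaklyRegular M rs) {i : ℕ}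
    (hi : i < rs.length) : Subsingleton (Ext N M i) := by
  induction rs generalizing M i with
  | nil => simp at hi
  | cons a rs ih =>
    simp only [List.mem_cons, forall_eq_or_imp] at hN
    rw [isWeaklyRegular_cons_iff] at hM
    cases i with
    | zero =>
      have hzero : ∀ (φ : N →ₗ[R] M) x, φ x = 0 := fun φ x => hM.1.right_eq_zero_of_smul (by
        rw [← map_smul, Module.mem_annihilator.1 hN.1, map_zero])
      have : Subsingleton (N →ₗ[R] M) := ⟨fun φ ψ => LinearMap.ext fun x => by
        rw [hzero, hzero]⟩
      exact (Ext.addEquiv₀.trans ModuleCat.homAddEquiv).subsingleton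
    | succ i =>
      have hsub : Subsingleton (Ext N (M.smulShortComplex a).X₃ i) :=
        ih (M := ModuleCat.of R (QuotSMulTop a M)) hN.2 hM.2 (Nat.lt_of_succ_lt_succ hi)
      -- multiplication by `a` on `Ext^(i+1)(N, M)` is injective, and it is zero as `a` kills `N`
      refine ⟨fun x y => ?_⟩
      have hzero : ∀ x : Ext N M (i + 1), x = 0 := by
        intro x
        have hx : x.comp (Ext.mk₀ (M.smulShortComplex a).f) (add_zero (i + 1)) = 0 :=
          congr($(Ext.postcomp_smul_id_eq_zero_of_mem_annihilator (M := M) hN.1 (i + 1)) x)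
        obtain ⟨z, rfl⟩ := Ext.covariant_sequence_exact₁ N hM.1.smulShortComplex_shortExact x hx rfl
        rw [hsub.elim z 0, Ext.zero_comp]
        rfl
      rw [hzero x, hzero y]

/-- A regular sequence on the ring is regular on every projective module. -/
lemma IsWeaklyRegular.of_projective {rs : List R} (h : IsWeaklyRegular R rs) (M : Type u)
    [AddCommGroup M] [Module R M] [Module.Projective R M] : IsWeaklyRegular M rs :=
  ((TensorProduct.lid R M).isWeaklyRegular_congr rs).1 h.isWeaklyRegular_rTensor

/-- If `N` is annihilated by an `R`-regular sequence of length `r` and `M` has projective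
dimension at most `p`, then `Ext^i(N, M) = 0` for `i + p < r`. -/
lemma subsingleton_ext_of_hasProjectiveDimensionLE {N M : ModuleCat.{u} R} {rs : List R}
    (hN : ∀ r ∈ rs, r ∈ Module.annihilator R N) (hR : IsWeaklyRegular R rs) {p : ℕ}
    (hM : HasProjectiveDimensionLE M p) {i : ℕ} (hi : i + p < rs.length) :
    Subsingleton (Ext N M i) := by
  induction p generalizing M i with
  | zero =>
    have : Projective M := projective_iff_hasProjectiveDimensionLE_zero M |>.2 hM
    have : Module.Projective R M := (IsProjective.iff_projective M).2 this
    exact subsingleton_ext_of_isWeaklyRegular hN (IsWeaklyRegular.of_projective hR M) hi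
  | succ p ih =>
    have hS := M.shortExact_projectiveShortComplex
    have h1 : HasProjectiveDimensionLE M.projectiveShortComplex.X₁ p :=
      (hS.hasProjectiveDimensionLT_X₃_iff p inferInstance).1 hM
    have h₁ := ih h1 (i := i + 1) (by omega)
    have h₂ : Subsingleton (Ext N M.projectiveShortComplex.X₂ i) :=
      subsingleton_ext_of_isWeaklyRegular hN (IsWeaklyRegular.of_projective hR _) (by omega)
    have hzero : ∀ x : Ext N M i, x = 0 := by
      intro x
      obtain ⟨y, rfl⟩ := Ext.covariant_sequence_exact₃ N hS x rfl (h₁.elim _ _)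
      rw [h₂.elim y 0, Ext.zero_comp]
    exact ⟨fun x y => by rw [hzero x, hzero y]⟩

/-- The quotient of a module by a regular sequence of length `r` has projective dimension larger
by at most `r`. -/
lemma hasProjectiveDimensionLE_quotient_of_isWeaklyRegular (rs : List R) (M : Type u)
    [AddCommGroup M] [Module R M] (hM : IsWeaklyRegular M rs) {p : ℕ}
    (hp : HasProjectiveDimensionLE (ModuleCat.of R M) p) :
    HasProjectiveDimensionLE
      (ModuleCat.of R (M ⧸ Ideal.ofList rs • (⊤ : Submodule R M))) (p + rs.length) := by
  induction rs generalizing M p with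
  | nil =>
    have e : M ≃ₗ[R] M ⧸ Ideal.ofList ([] : List R) • (⊤ : Submodule R M) :=
      (Submodule.quotEquivOfEqBot (Ideal.ofList ([] : List R) • (⊤ : Submodule R M))
        (by rw [Ideal.ofList_nil]; exact Submodule.bot_smul _)).symm
    exact hasProjectiveDimensionLT_of_iso e.toModuleIso _
  | cons a rs ih =>
    rw [isWeaklyRegular_cons_iff] at hM
    have h1 : HasProjectiveDimensionLE (ModuleCat.of R (QuotSMulTop a M)) (p + 1) :=
      (IsSMulRegular.smulShortComplex_shortExact (M := ModuleCat.of R M)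
        hM.1).hasProjectiveDimensionLT_X₃ (p + 1) hp
        (hasProjectiveDimensionLT_of_ge (ModuleCat.of R M) (p + 1) (p + 2) (by omega))
    have h2 := ih (QuotSMulTop a M) hM.2 h1
    have e := (Submodule.quotOfListConsSMulTopEquivQuotSMulTopInner M a rs).symm
    have := hasProjectiveDimensionLT_of_iso e.toModuleIso (p + 1 + rs.length + 1)
    rwa [List.length_cons, show p + (rs.length + 1) = p + 1 + rs.length by omega]

variable (I J : Ideal R)

/-- The Mayer–Vietoris sequence `0 → R/(I ∩ J) → R/I × R/J → R/(I + J) → 0` of two ideals. -/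
noncomputable def mayerVietorisComplex : ShortComplex (ModuleCat.{u} R) :=
  ModuleCat.shortComplexOfCompEqZero
    (M := R ⧸ I ⊓ J) (N := (R ⧸ I) × (R ⧸ J)) (L := R ⧸ I ⊔ J)
    ((Submodule.factor (p := I ⊓ J) (p' := I) inf_le_left).prod
      (Submodule.factor (p := I ⊓ J) (p' := J) inf_le_right))
    ((Submodule.factor (p := I) (p' := I ⊔ J) le_sup_left).comp (LinearMap.fst R _ _) -
      (Submodule.factor (p := J) (p' := I ⊔ J) le_sup_right).comp (LinearMap.snd R _ _))
    (by
      refine Submodule.linearMap_qext _ (LinearMap.ext fun x => ?_)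
      simp)

lemma mayerVietorisComplex_shortExact : (mayerVietorisComplex I J).ShortExact := by
  refine ModuleCat.shortComplex_shortExact _ ?_ ?_ ?_
  · rintro ⟨x, y⟩
    obtain ⟨x, rfl⟩ := Submodule.Quotient.mk_surjective _ x
    obtain ⟨y, rfl⟩ := Submodule.Quotient.mk_surjective _ y
    constructor
    · intro h
      have hxy : x - y ∈ I ⊔ J := (Submodule.Quotient.eq (I ⊔ J)).1 (sub_eq_zero.1 h)
      obtain ⟨i, hi, j, hj, hij⟩ := Submodule.mem_sup.1 hxy
      refine ⟨Submodule.Quotient.mk (x - i), Prod.ext ?_ ?_⟩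
      · exact (Submodule.Quotient.eq I).2 (by simpa using hi)
      · refine (Submodule.Quotient.eq J).2 ?_
        change x - i - y ∈ J
        rwa [show x - i - y = j by rw [sub_right_comm, ← hij, add_sub_cancel_left]]
    · rintro ⟨z, hz⟩
      rw [← hz]
      exact (mayerVietorisComplex I J).zero_apply z
  · refine (injective_iff_map_eq_zero (mayerVietorisComplex I J).f.hom).2 fun z hz => ?_
    obtain ⟨z, rfl⟩ := Submodule.Quotient.mk_surjective _ z
    exact (Submodule.Quotient.mk_eq_zero _).2
      ⟨(Submodule.Quotient.mk_eq_zero I).1 congr(($hz).1),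
        (Submodule.Quotient.mk_eq_zero J).1 congr(($hz).2)⟩
  · intro z
    obtain ⟨z, rfl⟩ := Submodule.Quotient.mk_surjective _ z
    refine ⟨(Submodule.Quotient.mk z, 0), ?_⟩
    change (Submodule.factor (le_sup_left : I ≤ I ⊔ J) (Submodule.Quotient.mk z) -
      Submodule.factor (le_sup_right : J ≤ I ⊔ J) 0 : R ⧸ I ⊔ J) = Submodule.Quotient.mk z
    rw [map_zero, sub_zero]
    rfl

/-- If `I` and `J` have quotients of finite projective dimension, as has `I + J`, then so does
the quotient by `I ∩ J`. -/
lemma exists_hasProjectiveDimensionLE_quotient_inf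
    (hI : ∃ p, HasProjectiveDimensionLE (ModuleCat.of R (R ⧸ I)) p)
    (hJ : ∃ p, HasProjectiveDimensionLE (ModuleCat.of R (R ⧸ J)) p)
    (hIJ : ∃ p, HasProjectiveDimensionLE (ModuleCat.of R (R ⧸ I ⊔ J)) p) :
    ∃ p, HasProjectiveDimensionLE (ModuleCat.of R (R ⧸ I ⊓ J)) p := by
  obtain ⟨a, ha⟩ := hI
  obtain ⟨b, hb⟩ := hJ
  obtain ⟨c, hc⟩ := hIJ
  let m := max (max a b) c + 1
  have ha' := hasProjectiveDimensionLT_of_ge (ModuleCat.of R (R ⧸ I)) (a + 1) m (by omega)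
  have hb' := hasProjectiveDimensionLT_of_ge (ModuleCat.of R (R ⧸ J)) (b + 1) m (by omega)
  have hc' := hasProjectiveDimensionLT_of_ge (ModuleCat.of R (R ⧸ I ⊔ J)) (c + 1) (m + 1)
    (by omega)
  have hprod : HasProjectiveDimensionLT (ModuleCat.of R ((R ⧸ I) × (R ⧸ J))) m :=
    hasProjectiveDimensionLT_of_iso (ModuleCat.biprodIsoProd (ModuleCat.of R (R ⧸ I))
      (ModuleCat.of R (R ⧸ J))) m
  have hinf : HasProjectiveDimensionLT (ModuleCat.of R (R ⧸ I ⊓ J)) m :=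
    (mayerVietorisComplex_shortExact I J).hasProjectiveDimensionLT_X₁ m hprod hc'
  exact ⟨m, hasProjectiveDimensionLT_of_ge (ModuleCat.of R (R ⧸ I ⊓ J)) m (m + 1) (by omega)⟩

variable {I J} in
/-- If `I + J` contains a regular sequence of length at least `p + 2`, where `p` bounds the
projective dimension of `R/(I ∩ J)`, then the map `R/I × R/J → R/(I + J)` splits, since
`Ext¹(R/(I + J), R/(I ∩ J))` vanishes. In terms of elements: there are `x` and `y` with
difference `1` modulo `I + J` that `I + J` multiplies into `I` and `J`, respectively. -/
lemma exists_mul_mem_of_hasProjectiveDimensionLE {rs : List R} (hrs : ∀ r ∈ rs, r ∈ I ⊔ J)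
    (hR : IsWeaklyRegular R rs) {p : ℕ}
    (hp : HasProjectiveDimensionLE (ModuleCat.of R (R ⧸ I ⊓ J)) p) (hlt : p + 2 ≤ rs.length) :
    ∃ x y : R, x - y - 1 ∈ I ⊔ J ∧ ∀ r ∈ I ⊔ J, r * x ∈ I ∧ r * y ∈ J := by
  have hExt : Subsingleton (Ext (mayerVietorisComplex I J).X₃ (mayerVietorisComplex I J).X₁ 1) :=
    subsingleton_ext_of_hasProjectiveDimensionLE
      (fun r hr => by
        rw [show Module.annihilator R (mayerVietorisComplex I J).X₃ = I ⊔ J from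
          Ideal.annihilator_quotient]
        exact hrs r hr) hR hp (by omega)
  obtain ⟨s, hs⟩ := Ext.covariant_sequence_exact₃ _ (mayerVietorisComplex_shortExact I J)
    (Ext.mk₀ (𝟙 (mayerVietorisComplex I J).X₃)) (zero_add 1) (hExt.elim _ _)
  obtain ⟨s, rfl⟩ := (Ext.mk₀_bijective _ _).2 s
  rw [Ext.mk₀_comp_mk₀, (Ext.mk₀_bijective _ _).1.eq_iff] at hs
  let σ : (R ⧸ I ⊔ J) →ₗ[R] (R ⧸ I) × (R ⧸ J) := s.hom
  obtain ⟨x, hx⟩ := Submodule.Quotient.mk_surjective _ (σ 1).1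
  obtain ⟨y, hy⟩ := Submodule.Quotient.mk_surjective _ (σ 1).2
  have hσ : (mayerVietorisComplex I J).g.hom (σ 1) = (1 : R ⧸ I ⊔ J) :=
    congr(($hs).hom (1 : R ⧸ I ⊔ J))
  refine ⟨x, y, ?_, fun r hr => ?_⟩
  · rw [show σ 1 = (Submodule.Quotient.mk x, Submodule.Quotient.mk y) from
      Prod.ext hx.symm hy.symm] at hσ
    exact (Submodule.Quotient.eq (I ⊔ J)).1 hσ
  · have h0 : r • σ 1 = 0 := by
      rw [← map_smul, show r • (1 : R ⧸ I ⊔ J) = 0 from ?_, map_zero]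
      rw [Algebra.smul_def, mul_one]
      exact Ideal.Quotient.eq_zero_iff_mem.2 hr
    constructor
    · refine (Submodule.Quotient.mk_eq_zero I).1 ?_
      rw [← smul_eq_mul, Submodule.Quotient.mk_smul, hx]
      exact congr(($h0).1)
    · refine (Submodule.Quotient.mk_eq_zero J).1 ?_
      rw [← smul_eq_mul, Submodule.Quotient.mk_smul, hy]
      exact congr(($h0).2)

end Homological

/-! ### Nonface ideals and clique complexes -/

section NonfaceIdeal

open MvPolynomial RingTheory.Sequence CategoryTheory

variable {σ : Type*} (k : Type*) [Field k]

/-- The span of the monomials whose support is not a face of the simplicial complex `Δ`, described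
through the supports of its elements. A complex is given as a lower set of finite sets, so that
unions and intersections of complexes are suprema and infima. -/
def nonfaceIdeal (Δ : LowerSet (Finset σ)) : Ideal (MvPolynomial σ k) where
  carrier := {p | ∀ m ∈ p.support, m.support ∉ Δ}
  zero_mem' := by simp
  add_mem' {p q} hp hq m hm := by
    classical
    rcases Finset.mem_union.1 (support_add hm) with h | h
    exacts [hp m h, hq m h]
  smul_mem' r p hp m hm := by
    classical
    obtain ⟨a, -, b, hb, rfl⟩ := Finset.mem_add.1 (support_mul r p hm)
    exact fun h => hp b hb (Δ.lower (Finsupp.support_mono (by simp)) h)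

variable {k}

lemma mem_nonfaceIdeal {Δ : LowerSet (Finset σ)} {p : MvPolynomial σ k} :
    p ∈ nonfaceIdeal k Δ ↔ ∀ m ∈ p.support, m.support ∉ Δ := Iff.rfl

lemma coeff_eq_zero_of_mem_nonfaceIdeal {Δ : LowerSet (Finset σ)} {p : MvPolynomial σ k}
    (hp : p ∈ nonfaceIdeal k Δ) {m : σ →₀ ℕ} (hm : m.support ∈ Δ) : p.coeff m = 0 := by
  by_contra h
  exact hp m (mem_support_iff.2 h) hm

lemma monomial_mem_nonfaceIdeal {Δ : LowerSet (Finset σ)} {m : σ →₀ ℕ} (hm : m.support ∉ Δ)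
    (c : k) : monomial m c ∈ nonfaceIdeal k Δ := by
  intro m' hm'
  rwa [Finset.mem_singleton.1 (support_monomial_subset hm')]

lemma X_mem_nonfaceIdeal {Δ : LowerSet (Finset σ)} {i : σ} (hi : {i} ∉ Δ) :
    X i ∈ nonfaceIdeal k Δ :=
  monomial_mem_nonfaceIdeal (by simpa using hi) 1

lemma nonfaceIdeal_sup (Δ Γ : LowerSet (Finset σ)) :
    nonfaceIdeal k (Δ ⊔ Γ) = nonfaceIdeal k Δ ⊓ nonfaceIdeal k Γ := by
  ext p
  simp only [Submodule.mem_inf, mem_nonfaceIdeal, LowerSet.mem_sup_iff, not_or]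
  exact ⟨fun h => ⟨fun m hm => (h m hm).1, fun m hm => (h m hm).2⟩,
    fun h m hm => ⟨h.1 m hm, h.2 m hm⟩⟩

lemma nonfaceIdeal_inf (Δ Γ : LowerSet (Finset σ)) :
    nonfaceIdeal k (Δ ⊓ Γ) = nonfaceIdeal k Δ ⊔ nonfaceIdeal k Γ := by
  refine le_antisymm (fun p hp => ?_) (sup_le ?_ ?_)
  · rw [← p.support_sum_monomial_coeff]
    refine Ideal.sum_mem _ fun m hm => ?_
    by_cases h : m.support ∈ Δ
    · exact Ideal.mem_sup_right (monomial_mem_nonfaceIdeal (fun h' => hp m hm ⟨h, h'⟩) _)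
    · exact Ideal.mem_sup_left (monomial_mem_nonfaceIdeal h _)
  · exact fun p hp m hm h => hp m hm h.1
  · exact fun p hp m hm h => hp m hm h.2

/-- The full simplex on the vertex set `U`. -/
def simplexOn (U : Set σ) : LowerSet (Finset σ) where
  carrier := {F | (F : Set σ) ⊆ U}
  lower' _ _ hab h := (Finset.coe_subset.2 hab).trans h

lemma mem_simplexOn {U : Set σ} {F : Finset σ} : F ∈ simplexOn U ↔ (F : Set σ) ⊆ U := Iff.rfl

lemma nonfaceIdeal_simplexOn (U : Set σ) :
    nonfaceIdeal k (simplexOn U) = Ideal.span (X '' Uᶜ) := by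
  ext p
  simp only [mem_nonfaceIdeal, mem_ideal_span_X_image, mem_simplexOn, Set.not_subset]
  simp [and_comm]

lemma isSMulRegular_X_quotient {T : Set σ} {v : σ} (hv : v ∉ T) :
    IsSMulRegular (MvPolynomial σ k ⧸ (Ideal.span (X '' T) : Ideal (MvPolynomial σ k)))
      (X v : MvPolynomial σ k) := by
  refine (isSMulRegular_quotient_iff_mem_of_smul_mem _ _).2 fun p hp => ?_
  rw [mem_ideal_span_X_image] at hp ⊢
  intro m hm
  obtain ⟨i, hi, hne⟩ := hp (Finsupp.single v 1 + m) (by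
    rw [smul_eq_mul, mem_support_iff, coeff_X_mul]
    exact mem_support_iff.1 hm)
  refine ⟨i, hi, ?_⟩
  have hiv : v ≠ i := fun h => hv (h ▸ hi)
  simpa [Finsupp.single_apply, hiv] using hne

/-- Distinct variables form a regular sequence. -/
lemma exists_isWeaklyRegular_X (k : Type*) [Field k] {T : Set σ} (hT : T.Finite) :
    ∃ rs : List (MvPolynomial σ k), rs.length = T.ncard ∧ IsWeaklyRegular (MvPolynomial σ k) rs ∧
      Ideal.ofList rs = Ideal.span (X '' T) := by
  induction T, hT using Set.Finite.induction_on with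
  | empty => exact ⟨[], by simp⟩
  | @insert v T hv hT ih =>
    obtain ⟨rs, hlen, hreg, hspan⟩ := ih
    refine ⟨rs ++ [X v], by simp [hlen, Set.ncard_insert_of_notMem hv hT], ?_, ?_⟩
    · rw [isWeaklyRegular_append_iff, isWeaklyRegular_singleton_iff]
      refine ⟨hreg, ?_⟩
      rw [smul_eq_mul, Ideal.mul_top, hspan]
      exact isSMulRegular_X_quotient hv
    · rw [Ideal.ofList_append, hspan, Ideal.ofList_singleton, Set.image_insert_eq,
        Ideal.span_insert, sup_comm]

lemma exists_hasProjectiveDimensionLE_simplexOn {σ : Type*} [Finite σ] (k : Type*) [Field k]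
    (U : Set σ) : ∃ p, HasProjectiveDimensionLE
      (ModuleCat.of (MvPolynomial σ k) (MvPolynomial σ k ⧸ nonfaceIdeal k (simplexOn U))) p := by
  obtain ⟨rs, -, hreg, hspan⟩ := exists_isWeaklyRegular_X k Uᶜ.toFinite
  have h0 : HasProjectiveDimensionLE
      (ModuleCat.of (MvPolynomial σ k) (MvPolynomial σ k)) 0 :=
    projective_iff_hasProjectiveDimensionLE_zero _ |>.1
      ((IsProjective.iff_projective _).1 inferInstance)
  refine ⟨0 + rs.length, ?_⟩
  have := hasProjectiveDimensionLE_quotient_of_isWeaklyRegular rs _ hreg h0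
  rwa [smul_eq_mul, Ideal.mul_top, hspan, ← nonfaceIdeal_simplexOn] at this

variable (G : SimpleGraph σ)

/-- The clique complex of the subgraph of `G` induced on `U`. -/
def cliquesOn (U : Set σ) : LowerSet (Finset σ) where
  carrier := {F | (F : Set σ) ⊆ U ∧ G.IsClique (F : Set σ)}
  lower' _ _ hab h :=
    ⟨(Finset.coe_subset.2 hab).trans h.1, h.2.subset (Finset.coe_subset.2 hab)⟩

variable {G}

lemma mem_cliquesOn {U : Set σ} {F : Finset σ} :
    F ∈ cliquesOn G U ↔ (F : Set σ) ⊆ U ∧ G.IsClique (F : Set σ) := Iff.rfl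

lemma cliquesOn_eq_simplexOn {U : Set σ} (hU : G.IsClique U) : cliquesOn G U = simplexOn U := by
  ext F
  exact ⟨fun h => h.1, fun h => ⟨h, hU.subset h⟩⟩

namespace SimpleGraph.IsCliqueSeparation

variable {U A S B : Set σ} (h : G.IsCliqueSeparation U A S B)
include h

lemma cliquesOn_eq_sup : cliquesOn G U = cliquesOn G (A ∪ S) ⊔ cliquesOn G (S ∪ B) := by
  ext F
  simp only [LowerSet.coe_sup, Set.mem_union, SetLike.mem_coe, mem_cliquesOn, ← h.union_eq]
  constructor
  · rintro ⟨hF, hcl⟩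
    by_cases hA : ∃ a ∈ F, a ∈ A
    · obtain ⟨a, haF, haA⟩ := hA
      refine Or.inl ⟨fun x hx => ?_, hcl⟩
      refine (hF hx).resolve_right fun hxB => ?_
      exact h.not_adj a haA x hxB (hcl haF hx fun hax =>
        Set.disjoint_left.1 h.disjoint haA (hax ▸ hxB))
    · push Not at hA
      refine Or.inr ⟨fun x hx => ?_, hcl⟩
      rcases hF hx with (hx' | hx') | hx'
      exacts [absurd hx' (hA x hx), Or.inl hx', Or.inr hx']
  · rintro (⟨hF, hcl⟩ | ⟨hF, hcl⟩)
    · exact ⟨hF.trans Set.subset_union_left, hcl⟩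
    · exact ⟨hF.trans (by rw [Set.union_assoc]; exact Set.subset_union_right), hcl⟩

lemma cliquesOn_inf : cliquesOn G (A ∪ S) ⊓ cliquesOn G (S ∪ B) = simplexOn S := by
  ext F
  constructor
  · rintro ⟨h1, h2⟩ x hx
    rcases h1.1 hx, h2.1 hx with ⟨hA | hS, hS' | hB⟩
    exacts [hS', absurd hB (Set.disjoint_left.1 h.disjoint hA), hS, hS]
  · exact fun hF => ⟨⟨hF.trans Set.subset_union_right, h.isClique.subset hF⟩,
      ⟨hF.trans Set.subset_union_left, h.isClique.subset hF⟩⟩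

lemma ncard_left_lt (hU : U.Finite) : (A ∪ S).ncard < U.ncard := by
  obtain ⟨b, hb⟩ := h.nonempty_right
  refine Set.ncard_lt_ncard ⟨h.union_eq ▸ Set.subset_union_left, fun hsub => ?_⟩ hU
  rcases hsub (h.union_eq.subset (Or.inr hb)) with hb' | hb'
  exacts [Set.disjoint_left.1 h.disjoint hb' hb, Set.disjoint_left.1 h.disjoint_right hb' hb]

lemma ncard_right_lt (hU : U.Finite) : (S ∪ B).ncard < U.ncard :=
  Set.union_comm B S ▸ h.symm.ncard_left_lt hU

end SimpleGraph.IsCliqueSeparation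

/-- Induction along clique separators: a property of the induced subgraphs of a chordal graph
holds if it holds for cliques and passes from the two sides of a clique separator to the whole. -/
lemma SimpleGraph.IsChordalGraph.induction_on_separation [Finite σ] (hG : G.IsChordalGraph)
    {P : Set σ → Prop} (clique : ∀ U, G.IsClique U → P U)
    (sep : ∀ U A S B, G.IsCliqueSeparation U A S B → P (A ∪ S) → P (S ∪ B) → P U) (U : Set σ) :
    P U := by
  induction hn : U.ncard using Nat.strong_induction_on generalizing U with
  | _ m ih =>
    subst hn
    by_cases hU : G.IsClique U
    · exact clique U hU
    · obtain ⟨A, S, B, h⟩ := hG.exists_isCliqueSeparation U.toFinite hU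
      exact sep U A S B h (ih _ (h.ncard_left_lt U.toFinite) _ rfl)
        (ih _ (h.ncard_right_lt U.toFinite) _ rfl)

lemma SimpleGraph.IsChordalGraph.exists_hasProjectiveDimensionLE [Finite σ]
    (hG : G.IsChordalGraph) (k : Type*) [Field k] (U : Set σ) :
    ∃ p, HasProjectiveDimensionLE
      (ModuleCat.of (MvPolynomial σ k) (MvPolynomial σ k ⧸ nonfaceIdeal k (cliquesOn G U))) p := by
  induction U using hG.induction_on_separation with
  | clique U hU =>
    rw [cliquesOn_eq_simplexOn hU]
    exact exists_hasProjectiveDimensionLE_simplexOn k U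
  | sep U A S B h hA hB =>
    rw [h.cliquesOn_eq_sup, nonfaceIdeal_sup]
    refine exists_hasProjectiveDimensionLE_quotient_inf _ _ hA hB ?_
    rw [← nonfaceIdeal_inf, h.cliquesOn_inf]
    exact exists_hasProjectiveDimensionLE_simplexOn k S

/-- If the clique `S` separates `G`, the Stanley–Reisner ring of the clique complex has projective
dimension at least `n - |S| - 1`. Otherwise the Mayer–Vietoris sequence of the two sides of `S`
would split, which is impossible in degree zero. -/
lemma SimpleGraph.IsCliqueSeparation.ncard_compl_le [Finite σ] {A S B : Set σ}
    (h : G.IsCliqueSeparation Set.univ A S B) {p : ℕ}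
    (hp : HasProjectiveDimensionLE (ModuleCat.of (MvPolynomial σ k)
      (MvPolynomial σ k ⧸ nonfaceIdeal k (cliquesOn G Set.univ))) p) :
    Sᶜ.ncard ≤ p + 1 := by
  by_contra! hlt
  obtain ⟨rs, hlen, hreg, hspan⟩ := exists_isWeaklyRegular_X k Sᶜ.toFinite
  have hsup : nonfaceIdeal k (cliquesOn G (A ∪ S)) ⊔ nonfaceIdeal k (cliquesOn G (S ∪ B)) =
      nonfaceIdeal k (simplexOn S) := by
    rw [← nonfaceIdeal_inf, h.cliquesOn_inf]
  rw [h.cliquesOn_eq_sup, nonfaceIdeal_sup] at hp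
  obtain ⟨x, y, hxy, hmul⟩ := exists_mul_mem_of_hasProjectiveDimensionLE (rs := rs)
    (fun r hr => by
      rw [hsup, nonfaceIdeal_simplexOn, ← hspan]
      exact Ideal.subset_span hr) hreg hp (by omega)
  rw [hsup] at hxy hmul
  have hX : ∀ i ∉ S, (X i : MvPolynomial σ k) ∈ nonfaceIdeal k (simplexOn S) := fun i hi =>
    X_mem_nonfaceIdeal (by simpa [mem_simplexOn] using hi)
  -- elements of the ideal of a side containing `i` have no term in `X i`
  have hcoeff : ∀ (i : σ) (q : MvPolynomial σ k) (W : Set σ), i ∈ W →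
      X i * q ∈ nonfaceIdeal k (cliquesOn G W) → q.coeff 0 = 0 := by
    intro i q W hi hq
    have := coeff_eq_zero_of_mem_nonfaceIdeal hq (m := Finsupp.single i 1 + 0)
      ⟨by simpa using hi, by simp⟩
    rwa [coeff_X_mul] at this
  obtain ⟨a, ha⟩ := h.nonempty_left
  obtain ⟨b, hb⟩ := h.nonempty_right
  have hx := hcoeff a x _ (Or.inl ha) (hmul _ (hX a (Set.disjoint_left.1 h.disjoint_left ha))).1
  have hy := hcoeff b y _ (Or.inr hb) (hmul _ (hX b (Set.disjoint_right.1 h.disjoint_right hb))).2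
  have h0 := coeff_eq_zero_of_mem_nonfaceIdeal hxy (m := 0) (by simp [mem_simplexOn])
  simp [hx, hy] at h0

end NonfaceIdeal

/-! ### Hilbert series along clique separators -/

section Hilbert

open MvPolynomial

variable {σ : Type*} [Finite σ]

/-- The exponents of degree `s` of the monomials supported on a face of `Δ`. -/
def faceExponents (Δ : LowerSet (Finset σ)) (s : ℕ) : Set (σ →₀ ℕ) :=
  {m | m.degree = s ∧ m.support ∈ Δ}

omit [Finite σ] in
lemma mem_faceExponents {Δ : LowerSet (Finset σ)} {s : ℕ} {m : σ →₀ ℕ} :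
    m ∈ faceExponents Δ s ↔ m.degree = s ∧ m.support ∈ Δ := Iff.rfl

lemma finite_faceExponents (Δ : LowerSet (Finset σ)) (s : ℕ) : (faceExponents Δ s).Finite :=
  (Finsupp.finite_of_degree_eq s).subset fun _ hm => hm.1

/-- The generating function of the numbers of monomials supported on faces of `Δ`, by degree. -/
noncomputable def faceSeries (Δ : LowerSet (Finset σ)) : PowerSeries ℤ :=
  PowerSeries.mk fun s => ((faceExponents Δ s).ncard : ℤ)

/-- The monomials supported on faces form a basis of the quotient by the nonface ideal. -/
lemma finrank_map_homogeneousSubmodule (k : Type*) [Field k]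
    (Δ : LowerSet (Finset σ)) (s : ℕ) :
    Module.finrank k ((homogeneousSubmodule σ k s).map
      (Ideal.Quotient.mkₐ k (nonfaceIdeal k Δ)).toLinearMap) = (faceExponents Δ s).ncard := by
  classical
  let b : faceExponents Δ s → MvPolynomial σ k ⧸ nonfaceIdeal k Δ := fun m =>
    Ideal.Quotient.mkₐ k (nonfaceIdeal k Δ) (monomial m.1 1)
  have hb : LinearIndependent k b := by
    rw [linearIndependent_iff']
    intro t g hg i hi
    have hmem : ∑ m ∈ t, monomial m.1 (g m) ∈ nonfaceIdeal k Δ := by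
      rw [← Ideal.Quotient.eq_zero_iff_mem, ← hg, map_sum]
      refine Finset.sum_congr rfl fun m _ => ?_
      rw [← map_smul, smul_monomial, smul_eq_mul, mul_one]
      rfl
    have h0 := coeff_eq_zero_of_mem_nonfaceIdeal hmem i.2.2
    rw [coeff_sum, Finset.sum_eq_single i] at h0
    · rwa [coeff_monomial, if_pos rfl] at h0
    · intro m _ hmi
      rw [coeff_monomial, if_neg fun h => hmi (Subtype.ext h)]
    · exact fun h => absurd hi h
  have hspan : (homogeneousSubmodule σ k s).map
      (Ideal.Quotient.mkₐ k (nonfaceIdeal k Δ)).toLinearMap = Submodule.span k (Set.range b) := by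
    refine le_antisymm ?_ (Submodule.span_le.2 ?_)
    · rintro _ ⟨p, hp, rfl⟩
      rw [AlgHom.toLinearMap_apply, ← p.support_sum_monomial_coeff, map_sum]
      refine Submodule.sum_mem _ fun m hm => ?_
      by_cases hmΔ : m.support ∈ Δ
      · have hdeg : m.degree = s := by
          rw [Finsupp.degree_eq_weight_one]
          exact hp (mem_support_iff.1 hm)
        have : Ideal.Quotient.mkₐ k (nonfaceIdeal k Δ) (monomial m (p.coeff m)) =
            p.coeff m • b ⟨m, hdeg, hmΔ⟩ := by
          rw [← map_smul, smul_monomial, smul_eq_mul, mul_one]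
        rw [this]
        exact Submodule.smul_mem _ _ (Submodule.subset_span ⟨_, rfl⟩)
      · have : Ideal.Quotient.mkₐ k (nonfaceIdeal k Δ) (monomial m (p.coeff m)) = 0 :=
          Ideal.Quotient.eq_zero_iff_mem.2 (monomial_mem_nonfaceIdeal hmΔ _)
        rw [this]
        exact Submodule.zero_mem _
    · rintro _ ⟨m, rfl⟩
      exact ⟨_, isHomogeneous_monomial 1 m.2.1, rfl⟩
  have := (finite_faceExponents Δ s).fintype
  rw [hspan, finrank_span_eq_card hb, ← Nat.card_eq_fintype_card, Nat.card_coe_set_eq]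

lemma faceSeries_sup_add_inf (Δ Γ : LowerSet (Finset σ)) :
    faceSeries (Δ ⊔ Γ) + faceSeries (Δ ⊓ Γ) = faceSeries Δ + faceSeries Γ := by
  ext s
  have hsup : faceExponents (Δ ⊔ Γ) s = faceExponents Δ s ∪ faceExponents Γ s := by
    ext m
    simp only [mem_faceExponents, Set.mem_union, LowerSet.mem_sup_iff]
    tauto
  have hinf : faceExponents (Δ ⊓ Γ) s = faceExponents Δ s ∩ faceExponents Γ s := by
    ext m
    simp only [mem_faceExponents, Set.mem_inter_iff, LowerSet.mem_inf_iff]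
    tauto
  simp only [faceSeries, map_add, PowerSeries.coeff_mk, hsup, hinf]
  exact_mod_cast Set.ncard_union_add_ncard_inter _ _ (finite_faceExponents Δ s)
    (finite_faceExponents Γ s)

/-- The monomials in the variables `insert v U` are those in the variables `U` and the multiples
by `v` of all of them. -/
lemma faceSeries_simplexOn_insert {U : Set σ} {v : σ} (hv : v ∉ U) :
    faceSeries (simplexOn (insert v U)) =
      faceSeries (simplexOn U) + PowerSeries.X * faceSeries (simplexOn (insert v U)) := by
  classical
  have hU : ∀ {m : σ →₀ ℕ}, m.support ∈ simplexOn U ↔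
      m.support ∈ simplexOn (insert v U) ∧ m v = 0 := by
    intro m
    simp only [mem_simplexOn]
    constructor
    · refine fun h => ⟨h.trans (Set.subset_insert v U), ?_⟩
      by_contra hne
      exact hv (h (by simpa using hne))
    · rintro ⟨h, hmv⟩ x hx
      refine (h hx).resolve_left ?_
      rintro rfl
      exact (by simpa using hx : m x ≠ 0) hmv
  ext s
  cases s with
  | zero =>
    have : faceExponents (simplexOn (insert v U)) 0 = faceExponents (simplexOn U) 0 := by
      ext m
      simp only [mem_faceExponents, hU]
      constructor
      · rintro ⟨h, h'⟩
        exact ⟨h, h', by simp [(Finsupp.degree_eq_zero_iff m).1 h]⟩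
      · exact fun h => ⟨h.1, h.2.1⟩
    simp [faceSeries, this]
  | succ s =>
    have hinj : Function.Injective fun m : σ →₀ ℕ => Finsupp.single v 1 + m :=
      add_right_injective _
    have hunion : faceExponents (simplexOn (insert v U)) (s + 1) =
        faceExponents (simplexOn U) (s + 1) ∪
          (fun m => Finsupp.single v 1 + m) '' faceExponents (simplexOn (insert v U)) s := by
      ext m
      simp only [Set.mem_union, Set.mem_image, mem_faceExponents, hU]
      constructor
      · rintro ⟨hdeg, hm⟩
        by_cases hmv : m v = 0
        · exact Or.inl ⟨hdeg, hm, hmv⟩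
        · have hle : Finsupp.single v 1 ≤ m := Finsupp.single_le_iff.2 (Nat.pos_of_ne_zero hmv)
          have hadd := add_tsub_cancel_of_le hle
          refine Or.inr ⟨m - Finsupp.single v 1, ⟨?_, ?_⟩, hadd⟩
          · rw [← hadd, map_add, Finsupp.degree_single] at hdeg
            omega
          · exact (simplexOn _).lower (Finsupp.support_mono tsub_le_self) hm
      · rintro (⟨h1, h2, -⟩ | ⟨m, ⟨h1, h2⟩, rfl⟩)
        · exact ⟨h1, h2⟩
        · refine ⟨by rw [map_add, Finsupp.degree_single, h1, add_comm], ?_⟩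
          rw [mem_simplexOn] at h2 ⊢
          intro x hx
          by_cases hxv : x = v
          · exact Or.inl hxv
          · refine h2 ?_
            simpa [Finsupp.single_apply, Ne.symm hxv] using hx
    have hdisj : Disjoint (faceExponents (simplexOn U) (s + 1))
        ((fun m => Finsupp.single v 1 + m) '' faceExponents (simplexOn (insert v U)) s) := by
      refine Set.disjoint_left.2 ?_
      rintro _ ⟨-, h⟩ ⟨m, -, rfl⟩
      have := (hU.1 h).2
      simp at this
    rw [map_add, PowerSeries.coeff_succ_X_mul]
    simp only [faceSeries, PowerSeries.coeff_mk]
    rw [hunion, Set.ncard_union_eq hdisj (finite_faceExponents _ _)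
      ((finite_faceExponents _ _).image _), Set.ncard_image_of_injective _ hinj]
    push_cast
    rfl

lemma one_sub_X_pow_mul_faceSeries_simplexOn (U : Set σ) :
    (1 - PowerSeries.X) ^ U.ncard * faceSeries (simplexOn U) = 1 := by
  induction U, U.toFinite using Set.Finite.induction_on with
  | empty =>
    rw [Set.ncard_empty, pow_zero, one_mul]
    ext s
    have : faceExponents (simplexOn (∅ : Set σ)) s = if s = 0 then {0} else ∅ := by
      ext m
      have : m.support ∈ simplexOn (∅ : Set σ) ↔ m = 0 := by
        simp [mem_simplexOn, Set.subset_empty_iff]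
      rw [mem_faceExponents, this]
      split_ifs with h
      · simp only [Set.mem_singleton_iff, and_iff_right_iff_imp]
        rintro rfl
        simp [h]
      · simp only [Set.mem_empty_iff_false, iff_false, not_and]
        rintro hdeg rfl
        exact h (by simpa using hdeg.symm)
    rw [faceSeries, PowerSeries.coeff_mk, PowerSeries.coeff_one, this]
    split_ifs <;> simp
  | @insert v U hv hU ih =>
    have h := faceSeries_simplexOn_insert hv
    rw [Set.ncard_insert_of_notMem hv hU, pow_succ, mul_assoc, sub_mul, one_mul,
      sub_eq_iff_eq_add.2 h, ih]

/-- The numerator of the Hilbert series of a complex over the denominator `(1 - z) ^ n`, where `n`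
is the number of variables. -/
noncomputable def kSeries (Δ : LowerSet (Finset σ)) : PowerSeries ℤ :=
  (1 - PowerSeries.X) ^ Nat.card σ * faceSeries Δ

lemma kSeries_sup (Δ Γ : LowerSet (Finset σ)) :
    kSeries (Δ ⊔ Γ) = kSeries Δ + kSeries Γ - kSeries (Δ ⊓ Γ) := by
  rw [kSeries, eq_sub_of_add_eq (faceSeries_sup_add_inf Δ Γ), kSeries, kSeries, kSeries]
  ring

lemma kSeries_simplexOn (U : Set σ) :
    kSeries (simplexOn U) = (1 - PowerSeries.X) ^ Uᶜ.ncard := by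
  rw [kSeries, ← Set.ncard_add_ncard_compl U, add_comm, pow_add, mul_assoc,
    one_sub_X_pow_mul_faceSeries_simplexOn, mul_one]

omit [Finite σ] in
lemma PowerSeries.coeff_one_sub_X_pow (m j : ℕ) :
    PowerSeries.coeff j ((1 - PowerSeries.X : PowerSeries ℤ) ^ m) =
      (-1) ^ j * (m.choose j : ℤ) := by
  have h : (1 - PowerSeries.X : PowerSeries ℤ) ^ m =
      PowerSeries.rescale (-1) (((1 + Polynomial.X) ^ m : Polynomial ℤ) : PowerSeries ℤ) := by
    simp [PowerSeries.rescale_X, sub_eq_add_neg]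
  rw [h, PowerSeries.coeff_rescale, Polynomial.coeff_coe, Polynomial.coeff_one_add_X_pow]

lemma coeff_kSeries_simplexOn_eq_zero {U W : Set σ} (hWU : W ⊆ U) {j : ℕ} (hj : Wᶜ.ncard < j) :
    PowerSeries.coeff j (kSeries (simplexOn U)) = 0 := by
  rw [kSeries_simplexOn]
  rw [PowerSeries.coeff_one_sub_X_pow, Nat.choose_eq_zero_of_lt
    ((Set.ncard_le_ncard (Set.compl_subset_compl.2 hWU)).trans_lt hj), Nat.cast_zero, mul_zero]

variable {G : SimpleGraph σ}

omit [Finite σ] in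
lemma SimpleGraph.IsCliqueSeparation.extend_left {U A S B A₁ S₁ B₁ : Set σ}
    (h : G.IsCliqueSeparation U A S B) (h₁ : G.IsCliqueSeparation (A ∪ S) A₁ S₁ B₁)
    (hS : Disjoint S B₁) : G.IsCliqueSeparation U (A₁ ∪ B) S₁ B₁ := by
  have hB : Disjoint (A₁ ∪ S₁ ∪ B₁) B := by
    rw [h₁.union_eq]
    exact h.disjoint.union_left h.disjoint_right
  have hB₁ : B₁ ⊆ A := fun x hx =>
    (h₁.union_eq.subset (Or.inr hx)).resolve_right fun hxS => Set.disjoint_left.1 hS hxS hx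
  rw [Set.disjoint_union_left, Set.disjoint_union_left] at hB
  exact {
    union_eq := by
      rw [← h.union_eq, ← h₁.union_eq]
      ext x
      simp only [Set.mem_union]
      tauto
    disjoint_left := h₁.disjoint_left.union_left hB.1.2.symm
    disjoint_right := h₁.disjoint_right
    disjoint := h₁.disjoint.union_left hB.2.symm
    nonempty_left := h₁.nonempty_left.inl
    nonempty_right := h₁.nonempty_right
    isClique := h₁.isClique
    not_adj := by
      rintro x (hx | hx) y hy hxy
      · exact h₁.not_adj x hx y hy hxy
      · exact h.not_adj y (hB₁ hy) x hx hxy.symm }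

omit [Finite σ] in
/-- A separator of one side of a clique separation separates the whole: as `S` is a clique, it
meets at most one of the two parts of that side, and the other part has no edges to `B`. -/
lemma SimpleGraph.IsCliqueSeparation.exists_extend {U A S B A₁ S₁ B₁ : Set σ}
    (h : G.IsCliqueSeparation U A S B) (h₁ : G.IsCliqueSeparation (A ∪ S) A₁ S₁ B₁) :
    ∃ A' B', G.IsCliqueSeparation U A' S₁ B' := by
  by_cases hS : Disjoint S B₁
  · exact ⟨_, _, h.extend_left h₁ hS⟩
  · refine ⟨_, _, h.extend_left h₁.symm (Set.disjoint_left.2 fun x hxS hxA => ?_)⟩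
    obtain ⟨y, hyS, hyB⟩ := Set.not_disjoint_iff.1 hS
    exact h₁.not_adj x hxA y hyB
      (h.isClique hxS hyS fun hxy => Set.disjoint_left.1 h₁.disjoint hxA (hxy ▸ hyB))

/-- An induced subgraph of a chordal graph that is not complete has a clique separator `S` such
that the numerator of its Hilbert series has degree at most `n - |S|`. -/
lemma SimpleGraph.IsChordalGraph.exists_separation_coeff_kSeries (hG : G.IsChordalGraph)
    (U : Set σ) : G.IsClique U ∨ ∃ S, (∃ A B, G.IsCliqueSeparation U A S B) ∧
      ∀ j, Sᶜ.ncard < j → PowerSeries.coeff j (kSeries (cliquesOn G U)) = 0 := by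
  induction U using hG.induction_on_separation with
  | clique U hU => exact Or.inl hU
  | sep U A S B h hA hB =>
    right
    let Q : PowerSeries ℤ → Prop := fun f => ∃ T, (∃ A B, G.IsCliqueSeparation U A T B) ∧
      ∀ j, Tᶜ.ncard < j → PowerSeries.coeff j f = 0
    -- of two separators, the smaller one gives the weaker bound
    have hQ : ∀ f g f', (∀ j, PowerSeries.coeff j f = 0 → PowerSeries.coeff j g = 0 →
        PowerSeries.coeff j f' = 0) → Q f → Q g → Q f' := by
      rintro f g f' hfg ⟨S₁, hS₁, h₁⟩ ⟨S₂, hS₂, h₂⟩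
      rcases le_total S₁ᶜ.ncard S₂ᶜ.ncard with hle | hle
      · exact ⟨S₂, hS₂, fun j hj => hfg j (h₁ j (hle.trans_lt hj)) (h₂ j hj)⟩
      · exact ⟨S₁, hS₁, fun j hj => hfg j (h₁ j hj) (h₂ j (hle.trans_lt hj))⟩
    have hside : ∀ {A B : Set σ}, G.IsCliqueSeparation U A S B →
        (G.IsClique (A ∪ S) ∨ ∃ T, (∃ A' B', G.IsCliqueSeparation (A ∪ S) A' T B') ∧
          ∀ j, Tᶜ.ncard < j → PowerSeries.coeff j (kSeries (cliquesOn G (A ∪ S))) = 0) →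
        Q (kSeries (cliquesOn G (A ∪ S))) := by
      rintro A B h (hcl | ⟨T, ⟨A', B', hT⟩, hcoeff⟩)
      · rw [cliquesOn_eq_simplexOn hcl]
        exact ⟨S, ⟨A, B, h⟩, fun j hj =>
          coeff_kSeries_simplexOn_eq_zero Set.subset_union_right hj⟩
      · exact ⟨T, h.exists_extend hT, hcoeff⟩
    have h1 := hside h hA
    have h2 := hside h.symm (Set.union_comm S B ▸ hB)
    have h3 : Q (kSeries (simplexOn S)) :=
      ⟨S, ⟨A, B, h⟩, fun j hj => coeff_kSeries_simplexOn_eq_zero subset_rfl hj⟩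
    rw [h.cliquesOn_eq_sup, kSeries_sup, h.cliquesOn_inf, Set.union_comm S B]
    have h12 : Q (kSeries (cliquesOn G (A ∪ S)) + kSeries (cliquesOn G (B ∪ S))) :=
      hQ _ _ _ (fun j hf hg => by rw [map_add, hf, hg, add_zero]) h1 h2
    exact hQ _ _ _ (fun j hf hg => by rw [map_sub, hf, hg, sub_zero]) h12 h3

end Hilbert

/-! ### Stanley–Reisner rings of clique complexes -/

section StanleyReisner

open MvPolynomial CategoryTheory

variable {n : ℕ}

lemma stanleyReisnerIdeal_cliqueComplex (k : Type*) [Field k] (G : SimpleGraph (Fin n)) :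
    (cliqueComplex G).stanleyReisnerIdeal k = nonfaceIdeal k (cliquesOn G Set.univ) := by
  classical
  have hface : ∀ F : Finset (Fin n), F ∈ (cliqueComplex G).faces ↔ F ∈ cliquesOn G Set.univ := by
    intro F
    simp [cliqueComplex, mem_cliquesOn]
  refine le_antisymm (Ideal.span_le.2 ?_) fun p hp => ?_
  · rintro _ ⟨F, hF, rfl⟩
    rw [hface] at hF
    let m : Fin n →₀ ℕ := ∑ i ∈ F, Finsupp.single i 1
    have hm : m.support = F := by
      ext i
      simp [m, Finsupp.finsetSum_apply, Finsupp.single_apply]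
    have hmon : ∏ i ∈ F, (X i : MvPolynomial (Fin n) k) = monomial m 1 := by
      rw [monomial_sum_one]
      rfl
    rw [hmon]
    exact monomial_mem_nonfaceIdeal (hm ▸ hF) 1
  · rw [← p.support_sum_monomial_coeff]
    refine Ideal.sum_mem _ fun m hm => ?_
    have hgen : ∏ i ∈ m.support, X i ∈ (cliqueComplex G).stanleyReisnerIdeal k :=
      Ideal.subset_span ⟨m.support, fun h => hp m hm ((hface _).1 h), rfl⟩
    refine Ideal.mem_of_dvd _ ?_ hgen
    rw [monomial_eq]
    refine Dvd.dvd.mul_left (Finset.prod_dvd_prod_of_dvd _ _ fun i hi => ?_) _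
    exact dvd_pow_self _ (by simpa using hi)

lemma hilbertSeries_cliqueComplex (k : Type*) [Field k] (G : SimpleGraph (Fin n)) :
    (cliqueComplex G).hilbertSeries k = faceSeries (cliquesOn G Set.univ) := by
  ext s
  have key : ∀ I : Ideal (MvPolynomial (Fin n) k), I = nonfaceIdeal k (cliquesOn G Set.univ) →
      Module.finrank k ((homogeneousSubmodule (Fin n) k s).map
        (Ideal.Quotient.mkₐ k I).toLinearMap) = (faceExponents (cliquesOn G Set.univ) s).ncard := by
    rintro _ rfl
    exact finrank_map_homogeneousSubmodule k _ s
  rw [FaceComplex.hilbertSeries, faceSeries, PowerSeries.coeff_mk, PowerSeries.coeff_mk]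
  exact congrArg Nat.cast (key _ (stanleyReisnerIdeal_cliqueComplex k G))

/-- The alternating sums of the `h`-vector are the coefficients of the numerator of the Hilbert
series over the denominator `(1 - z) ^ n`. -/
lemma sum_hVector_eq_coeff_kSeries (k : Type*) [Field k] (G : SimpleGraph (Fin n)) (j : ℕ) :
    ∑ l ∈ Finset.range (j + 1), (-1 : ℤ) ^ l * (cliqueComplex G).hVector k (j - l) *
      ((n - (cliqueComplex G).maxFaceCard).choose l : ℤ) =
    PowerSeries.coeff j (kSeries (cliquesOn G Set.univ)) := by
  have hle : (cliqueComplex G).maxFaceCard ≤ n :=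
    Finset.sup_le fun F _ => (Finset.card_le_univ F).trans_eq (Fintype.card_fin n)
  have hpow : (1 - PowerSeries.X : PowerSeries ℤ) ^ n =
      (1 - PowerSeries.X) ^ (n - (cliqueComplex G).maxFaceCard) *
        (1 - PowerSeries.X) ^ (cliqueComplex G).maxFaceCard := by
    rw [← pow_add, Nat.sub_add_cancel hle]
  rw [kSeries, Nat.card_eq_fintype_card, Fintype.card_fin, hpow, mul_assoc, PowerSeries.coeff_mul,
    Finset.Nat.sum_antidiagonal_eq_sum_range_succ_mk]
  refine Finset.sum_congr rfl fun l _ => ?_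
  rw [PowerSeries.coeff_one_sub_X_pow, FaceComplex.hVector, hilbertSeries_cliqueComplex]
  ring

theorem mainTheorem4 {k : Type*} [Field k] {n : ℕ} (G : SimpleGraph (Fin n))
    (hG : G.IsChordalGraph) (d : ℕ) (hd : (d : ℤ) = (cliqueComplex G).dim + 1) :
    ∃ p : ℕ, (cliqueComplex G).projDim k = (p : WithBot ℕ∞) ∧
      ∀ j : ℕ, p + 2 < j →
        ∑ l ∈ Finset.range (j + 1),
          (-1 : ℤ) ^ l * (cliqueComplex G).hVector k (j - l) * ((n - d).choose l : ℤ) = 0 := by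
  obtain rfl : d = (cliqueComplex G).maxFaceCard := by
    rw [FaceComplex.dim] at hd
    omega
  simp only [sum_hVector_eq_coeff_kSeries]
  let M := ModuleCat.of (MvPolynomial (Fin n) k)
    (MvPolynomial (Fin n) k ⧸ nonfaceIdeal k (cliquesOn G Set.univ))
  have hproj : (cliqueComplex G).projDim k = projectiveDimension M :=
    congrArg (fun I : Ideal (MvPolynomial (Fin n) k) => projectiveDimension
      (ModuleCat.of (MvPolynomial (Fin n) k) (MvPolynomial (Fin n) k ⧸ I)))
      (stanleyReisnerIdeal_cliqueComplex k G)
  rw [hproj]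
  have hbot : projectiveDimension M ≠ ⊥ := by
    rw [Ne, projectiveDimension_eq_bot_iff, ModuleCat.isZero_iff_subsingleton,
      not_subsingleton_iff_nontrivial]
    refine Ideal.Quotient.nontrivial_iff.2 ((Ideal.ne_top_iff_one _).2 fun h1 => ?_)
    have := coeff_eq_zero_of_mem_nonfaceIdeal h1 (m := 0) (by simp [mem_cliquesOn])
    simp at this
  have htop : projectiveDimension M ≠ ⊤ :=
    (projectiveDimension_ne_top_iff M).2 (hG.exists_hasProjectiveDimensionLE k Set.univ)
  obtain ⟨p, hp⟩ : ∃ p : ℕ, projectiveDimension M = p := by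
    cases h : projectiveDimension M with
    | bot => exact absurd h hbot
    | coe q =>
      cases q with
      | top => exact absurd h htop
      | coe p => exact ⟨p, rfl⟩
  refine ⟨p, hp, fun j hj => ?_⟩
  rcases hG.exists_separation_coeff_kSeries Set.univ with hcl | ⟨S, ⟨A, B, hS⟩, hcoeff⟩
  · rw [cliquesOn_eq_simplexOn hcl]
    exact coeff_kSeries_simplexOn_eq_zero subset_rfl (by rw [Set.compl_univ, Set.ncard_empty]; omega)
  · have := hS.ncard_compl_le ((projectiveDimension_le_iff M p).1 hp.le)
    exact hcoeff j (by omega)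

end StanleyReisner
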